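/- Let $n\ge 0$. Let $R$ be the union of the unit squares ("boxes"), rotated by $45^\circ$, with centres $(x,y)\in\mathbb{Z}^2$ such that $x\ge 0$, $y\ge 1$, $x+y$ is odd and $x+y\le 2n-1$; the box with centre $(x,y)$ has corners $(x\pm1,y)$, $(x,y\pm1)$. Thus $R$ is the region bounded by the zigzag path $\lambda_b$ through $(0,0),(1,1),(2,0),(3,1),\ldots,(2n,0)$, the segment from $(0,2n)$ to $(2n,0)$ and the line $x=0$, together with the whole of the boxes centred on $x=0$. The latter, the anchor boxes, are labelled $1,\ldots,n$ from top to bottom. A Dyck tile is a ribbon of boxes whose centres, joined successively by a line, form a Dyck path (with steps $(1,1)$ and $(1,-1)$); its size is $k$ if this Dyck path has $2k$ steps, so a single box has size $0$. A cover-inclusive Dyck tiling of $R$ is a tiling of $R$ by Dyck tiles such that each tile, moved by $(0,-2)$, is contained in another tile or lies below $\lambda_b$. The entry of a tile is the upper left edge of its leftmost box, and its exit is the lower right edge of its rightmost box. The trajectory of label $i$ enters the tile whose leftmost box is the anchor box labelled $i$ at its entry, leaves it at its exit, continues into the tile whose entry is that edge, if there is one, and so on; it ends at the exit of the last tile reached.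 Write $i$ at the peak of $\lambda_b$ that lies on the vertical line through the upper end point of this last edge. A tiling corresponds to the permutation $w=w_1\cdots w_n$ of $\{1,\ldots,n\}$ if the labels written at the $n$ peaks of $\lambda_b$, read from right to left, are $w_1,\ldots,w_n$. Let $S_n(231)$ be the set of permutations $w$ of $\{1,\ldots,n\}$ for which there are no $i<j<k$ with $w_k<w_i<w_j$. For a tiling $D$ let $\mathrm{wt}'(D)$ be the sum of the sizes of its tiles. Let $C_0(q),C_1(q),\ldots\in\mathbb{Z}[q]$ be defined by the identity of formal power series $$z=\sum_{m\ge1}C_{m-1}(q)\,z^m(1-z)(1-qz)\cdots(1-q^{m-1}z).$$ Then to each permutation $w$ of $\{1,\ldots,n\}$ there corresponds exactly one cover-inclusive Dyck tiling $D(w)$ of $R$, and, in $\mathbb{Z}[q,q^{-1}]$, $$\sum_{w\in S_n(231)}q^{\mathrm{wt}'(D(w))}=q^{\binom n2}\,C_n(q^{-1}).$$ -/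

import Mathlib

open scoped Polynomial PowerSeries LaurentPolynomial

noncomputable section

/-- A unit square (rotated by 45 degrees), represented by the coordinates of its centre `(x, y)`.
Its corners are `(x - 1, y)`, `(x, y + 1)`, `(x + 1, y)`, `(x, y - 1)`. -/
abbrev Box : Type := ℤ × ℤ

/-- An up step, that is a segment from `(x, y)` to `(x + 1, y + 1)`, represented by its lower left
end point `(x, y)`. -/
abbrev UpStep : Type := ℤ × ℤ

/-- The boxes of the region bounded by the zigzag path `(0,0), (1,1), (2,0), …, (2n,0)`, the
line segment from `(0, 2n)` to `(2n, 0)` and the line `x = 0`. The boxes with centre on the line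
`x = 0` (the anchor boxes) belong to the region. -/
def region (n : ℕ) : Set Box :=
  {b | 0 ≤ b.1 ∧ 1 ≤ b.2 ∧ b.1 + b.2 ≤ 2 * (n : ℤ) - 1 ∧ Odd (b.1 + b.2)}

/-- A Dyck tile: a ribbon of boxes such that the line through the centres of its boxes
is a Dyck path. It is given by its leftmost box and by that Dyck path. -/
@[ext]
structure DyckTile where
  /-- the leftmost box -/
  start : Box
  /-- the Dyck path (possibly empty) formed by the centres of the boxes -/
  path : DyckWord

namespace DyckTile

/-- The centre of the `i`-th box of a tile: the end point of the first `i` steps of the path. -/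
def boxAt (d : DyckTile) (i : ℕ) : Box :=
  (d.start.1 + i,
    d.start.2 + ((d.path.toList.take i).count DyckStep.U : ℤ)
      - ((d.path.toList.take i).count DyckStep.D : ℤ))

/-- The set of boxes of a tile. -/
def boxes (d : DyckTile) : Set Box :=
  {b | ∃ i ≤ d.path.toList.length, b = d.boxAt i}

/-- The size of a tile is the size of its Dyck path (a single box has size zero). -/
def size (d : DyckTile) : ℕ := d.path.semilength

/-- The leftmost up step on the boundary of a tile: the upper left edge of its leftmost box. -/
def entry (d : DyckTile) : UpStep := (d.start.1 - 1, d.start.2)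

/-- The rightmost up step on the boundary of a tile: the lower right edge of its rightmost box. -/
def exit (d : DyckTile) : UpStep :=
  ((d.boxAt d.path.toList.length).1, (d.boxAt d.path.toList.length).2 - 1)

end DyckTile

/-- Translation of a set of boxes by `(0, -2)`. -/
def moveDown (s : Set Box) : Set Box := {b | (b.1, b.2 + 2) ∈ s}

/-- The boxes whose interior lies below the zigzag path. -/
def belowZigzag : Set Box := {b | b.2 ≤ 0}

/-- The cover-inclusive Dyck tilings of the region: a set of Dyck tiles contained in the region,
covering each box of the region exactly once, such that each tile, moved down by `(0, -2)`,
is contained in a tile or lies below the zigzag path. -/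
@[ext]
structure DyckTiling (n : ℕ) where
  /-- the tiles of the tiling -/
  tiles : Finset DyckTile
  subset_region : ∀ d ∈ tiles, d.boxes ⊆ region n
  tiling : ∀ b ∈ region n, ∃! d, d ∈ tiles ∧ b ∈ d.boxes
  cover_inclusive : ∀ d ∈ tiles,
    (∃ d' ∈ tiles, moveDown d.boxes ⊆ d'.boxes) ∨ moveDown d.boxes ⊆ belowZigzag

namespace DyckTiling

variable {n : ℕ}

/-- The anchor box labelled `i + 1`; the labels `1, …, n` increase from top to bottom. -/
def anchorBox (n : ℕ) (i : Fin n) : Box := (0, 2 * ((n : ℤ) - 1 - (i : ℤ)) + 1)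

/-- The trajectory which starts at the entry of the anchor box labelled `i + 1` ends at the
up step `u`. The trajectory enters a tile at its entry, leaves it at its exit, and is continued
into the next tile whenever this exit is the entry of another tile of the tiling. -/
def TrajectoryEndsAt (T : DyckTiling n) (i : Fin n) (u : UpStep) : Prop :=
  ∃ d₀ ∈ T.tiles, ∃ d ∈ T.tiles,
    d₀.start = anchorBox n i ∧
    Relation.ReflTransGen (fun e e' => e' ∈ T.tiles ∧ e.exit = e'.entry) d₀ d ∧
    (∀ d' ∈ T.tiles, d.exit ≠ d'.entry) ∧
    u = d.exit

/-- The `x`-coordinate of the `(j + 1)`-st peak, counted from right to left, of the zigzag path,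
whose peaks are `(1, 1), (3, 1), …, (2n - 1, 1)`. -/
def peakX (n : ℕ) (j : Fin n) : ℤ := 2 * ((n : ℤ) - 1 - (j : ℤ)) + 1

/-- The tiling `T` corresponds to the permutation `w`: for each `j`, the trajectory that starts
at the anchor box labelled by the `j`-th letter of `w` ends at an up step (of the zigzag path or
of a tile) whose upper end point lies on the vertical line through the `j`-th peak from the right,
so that reading the labels of the peaks from right to left gives `w`. -/
def Corresponds (T : DyckTiling n) (w : Equiv.Perm (Fin n)) : Prop :=
  ∀ j : Fin n, ∃ u : UpStep, T.TrajectoryEndsAt (w j) u ∧ u.1 + 1 = peakX n j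

/-- The weight of a tiling: the sum of the sizes of its tiles. -/
def weight (T : DyckTiling n) : ℕ := ∑ d ∈ T.tiles, d.size

end DyckTiling

/-- The permutations `w` of `n` letters without `i < j < k` such that `w k < w i < w j`. -/
def perms231Avoiding (n : ℕ) : Finset (Equiv.Perm (Fin n)) :=
  Finset.univ.filter fun w => ∀ i j k : Fin n, i < j → j < k → ¬ (w k < w i ∧ w i < w j)

/-- The product `(1 - z)(1 - q z) ⋯ (1 - q ^ (k - 1) z)` as a power series in `z` over `ℤ[q]`. -/
def qPochhammer (k : ℕ) : ℤ[X]⟦X⟧ :=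
  ∏ i ∈ Finset.range k, (1 - PowerSeries.C ((Polynomial.X : ℤ[X]) ^ i) * PowerSeries.X)

/-- The identity of formal power series
`z = ∑_{m ≥ 1} c (m - 1) z ^ m (1 - z)(1 - q z) ⋯ (1 - q ^ (m - 1) z)` over `ℤ[q]`: for each `k`,
the coefficient of `z ^ k` in the partial sums is eventually that of `z`. -/
def IsQCatalanSeq (c : ℕ → ℤ[X]) : Prop :=
  ∀ k N : ℕ, k ≤ N →
    PowerSeries.coeff k
      (∑ m ∈ Finset.Icc 1 N, PowerSeries.C (c (m - 1)) * PowerSeries.X ^ m * qPochhammer m)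
    = PowerSeries.coeff k (PowerSeries.X : ℤ[X]⟦X⟧)

/-- The `q`-Catalan number `C_m(q)`: the unique sequence that satisfies `IsQCatalanSeq`, solved
for its terms by comparing coefficients of `z ^ (m + 1)`. -/
def qCatalan (m : ℕ) : ℤ[X] :=
  (if m = 0 then 1 else 0)
    - ∑ k : Fin m, qCatalan k * PowerSeries.coeff (m - (k : ℕ)) (qPochhammer ((k : ℕ) + 1))
  termination_by m
  decreasing_by exact k.2

theorem coeff_partialSum (c : ℕ → ℤ[X]) {k N : ℕ} (h : k ≤ N) :
    PowerSeries.coeff k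
      (∑ m ∈ Finset.Icc 1 N, PowerSeries.C (c (m - 1)) * PowerSeries.X ^ m * qPochhammer m)
    = ∑ i ∈ Finset.range k, c i * PowerSeries.coeff (k - (i + 1)) (qPochhammer (i + 1)) := by
  have h1 : Finset.Icc 1 N = (Finset.range N).image (· + 1) := by
    ext a
    simp only [Finset.mem_Icc, Finset.mem_image, Finset.mem_range]
    constructor
    · rintro ⟨h1, h2⟩
      exact ⟨a - 1, by omega, by omega⟩
    · rintro ⟨b, hb, rfl⟩
      omega
  rw [h1, Finset.sum_image (by intro a _ b _ hab; simpa using hab), map_sum,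
    ← Finset.sum_subset (Finset.range_subset_range.2 h)]
  · refine Finset.sum_congr rfl fun i hi => ?_
    rw [mul_assoc, PowerSeries.coeff_C_mul, PowerSeries.coeff_X_pow_mul',
      if_pos (by simpa [Nat.succ_le_iff] using hi)]
    simp
  · intro i _ hi
    rw [mul_assoc, PowerSeries.coeff_C_mul, PowerSeries.coeff_X_pow_mul', if_neg, mul_zero]
    simpa [Nat.succ_le_iff] using hi

theorem qPochhammer_coeff_zero (k : ℕ) : PowerSeries.coeff 0 (qPochhammer k) = 1 := by
  simp [qPochhammer, PowerSeries.coeff_zero_eq_constantCoeff, map_prod]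

theorem isQCatalanSeq_iff (c : ℕ → ℤ[X]) : IsQCatalanSeq c ↔
    ∀ m, c m = (if m = 0 then 1 else 0)
      - ∑ k : Fin m, c k * PowerSeries.coeff (m - (k : ℕ)) (qPochhammer ((k : ℕ) + 1)) := by
  have key : ∀ m, ∑ i ∈ Finset.range (m + 1),
      c i * PowerSeries.coeff (m + 1 - (i + 1)) (qPochhammer (i + 1))
      = (∑ k : Fin m, c k * PowerSeries.coeff (m - (k : ℕ)) (qPochhammer ((k : ℕ) + 1))) + c m := by
    intro m
    rw [Finset.sum_range_succ, Fin.sum_univ_eq_sum_range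
      (fun k => c k * PowerSeries.coeff (m - k) (qPochhammer (k + 1)))]
    simp only [Nat.add_sub_add_right, Nat.sub_self, qPochhammer_coeff_zero, mul_one]
  constructor
  · intro h m
    have := h (m + 1) (m + 1) le_rfl
    rw [coeff_partialSum c le_rfl, key, PowerSeries.coeff_X] at this
    simp only [Nat.add_eq_right] at this
    rw [← this]
    ring
  · intro h k N hk
    rw [coeff_partialSum c hk]
    cases k with
    | zero => simp [PowerSeries.coeff_X]
    | succ m =>
      rw [key, PowerSeries.coeff_X]
      simp only [Nat.add_eq_right]
      conv_lhs => rw [h m]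
      ring

/-- The `q`-Catalan numbers satisfy their defining identity. -/
theorem qCatalan_isQCatalanSeq : IsQCatalanSeq qCatalan :=
  (isQCatalanSeq_iff qCatalan).2 fun m => by rw [qCatalan]

/-- The `q`-Catalan numbers are the only solution of their defining identity. -/
theorem IsQCatalanSeq.eq_qCatalan {c : ℕ → ℤ[X]} (h : IsQCatalanSeq c) : c = qCatalan := by
  rw [isQCatalanSeq_iff] at h
  funext m
  induction m using Nat.strong_induction_on with
  | _ m ih =>
    rw [h m, qCatalan]
    congr 1
    exact Finset.sum_congr rfl fun k _ => by rw [ih k k.2]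

end

/-!
Row `r` of the region consists of the boxes of heights `2r + 1` and `2r + 2`. Moving a tile down
repeatedly keeps it in a single tile until it reaches the row above the zigzag path, so a tile of a
cover-inclusive tiling lies in one row: it is a ribbon with Dyck path `(UD)^k` that starts at odd
height, or a single box of even height. Cover-inclusiveness also says that two adjacent boxes of odd
height are in the same tile in the `c b` lowest rows only, where `c b` depends on the column `b`.
The code `c` is arbitrary subject to `c b ≤ n - 1 - b` for `b < n`, it determines the tiling, and
the weight of the tiling is the sum of its terms.

A trajectory that passes column `b` in row `r` stays in its row if `r < c b`, ends if `r = c b`, and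
drops by one row if `r > c b`. Hence the tiling whose code counts, for each letter of `w` read from
the right, the greater letters before it corresponds to `w`: the row of the trajectory of `v` is the
number of letters greater than `v` among those not yet passed. A tiling determines the permutation,
there are `n!` permutations and `n!` codes, and so each tiling corresponds to exactly one
permutation.

The weight of `D(w)` is the number of inversions of `w`, so it is `n.choose 2` minus the sum of the
numbers `e i` of smaller letters before the `i`-th one, and `w` avoids 231 if and only if `e` is
weakly increasing. It remains to sum `q ^ (e 0 + ⋯ + e (n - 1))` over the weakly increasing `e` with
`e i ≤ i`. Removing the last term of `e` gives a recursion, and summation by parts against the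
coefficients of `(1 - z) ⋯ (1 - q ^ (k - 1) z)` turns it into the defining identity of `C_n(q)`.
-/

section

open Finset

/-! ### Zigzag tiles -/

/-- The Dyck word `(UD)^k`, whose path alternates between the heights `0` and `1`. -/
def zigzagWord (k : ℕ) : DyckWord := k • (0 : DyckWord).nest

theorem toList_zigzagWord_succ (k : ℕ) :
    (zigzagWord (k + 1)).toList = DyckStep.U :: DyckStep.D :: (zigzagWord k).toList := by
  rw [zigzagWord, succ_nsmul']
  rfl

theorem semilength_zigzagWord (k : ℕ) : (zigzagWord k).semilength = k := by
  induction k with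
  | zero => simp [zigzagWord]
  | succ k ih =>
    rw [zigzagWord] at ih ⊢
    simp [succ_nsmul, ih]

theorem length_zigzagWord (k : ℕ) : (zigzagWord k).toList.length = 2 * k := by
  rw [← DyckWord.two_mul_semilength_eq_length, semilength_zigzagWord]

theorem count_U_take_zigzagWord {k i : ℕ} (h : i ≤ 2 * k) :
    ((zigzagWord k).toList.take i).count DyckStep.U =
      ((zigzagWord k).toList.take i).count DyckStep.D + i % 2 := by
  induction k generalizing i with
  | zero => simp [Nat.le_zero.1 h]
  | succ k ih =>
    match i with
    | 0 => simp
    | 1 => simp [toList_zigzagWord_succ]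
    | i + 2 =>
      have := ih (i := i) (by omega)
      simp only [toList_zigzagWord_succ, List.take_succ_cons, List.count_cons, beq_self_eq_true,
        reduceCtorEq, beq_iff_eq, if_true, if_false]
      omega

theorem exists_eq_toList_zigzagWord (l : List DyckStep)
    (nonneg : ∀ i, (l.take i).count DyckStep.D ≤ (l.take i).count DyckStep.U)
    (le_one : ∀ i, (l.take i).count DyckStep.U ≤ (l.take i).count DyckStep.D + 1)
    (balanced : l.count DyckStep.U = l.count DyckStep.D) :
    ∃ k, l = (zigzagWord k).toList := by
  match l with
  | [] => exact ⟨0, rfl⟩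
  | [s] => cases s <;> simp at balanced
  | s :: s' :: t =>
    obtain rfl : s = DyckStep.U := by
      have := nonneg 1
      cases s <;> simp_all
    obtain rfl : s' = DyckStep.D := by
      have := le_one 2
      cases s' <;> simp_all
    obtain ⟨k, rfl⟩ := exists_eq_toList_zigzagWord t (fun i => by simpa using nonneg (i + 2))
      (fun i => by simpa using le_one (i + 2)) (by simpa using balanced)
    exact ⟨k + 1, (toList_zigzagWord_succ k).symm⟩

namespace DyckTile

theorem start_mem_boxes (d : DyckTile) : d.start ∈ d.boxes :=
  ⟨0, Nat.zero_le _, by simp [boxAt]⟩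

theorem moveDown_boxes (d : DyckTile) :
    moveDown d.boxes = (⟨(d.start.1, d.start.2 - 2), d.path⟩ : DyckTile).boxes := by
  ext ⟨x, y⟩
  refine exists_congr fun i => and_congr_right fun _ => ?_
  simp only [boxAt, Prod.mk.injEq]
  omega

/-- The tile with leftmost box `s` and Dyck path `(UD)^k`. -/
def zigzag (s : Box) (k : ℕ) : DyckTile := ⟨s, zigzagWord k⟩

theorem size_zigzag (s : Box) (k : ℕ) : (zigzag s k).size = k := semilength_zigzagWord k

theorem boxAt_zigzag (s : Box) {k i : ℕ} (h : i ≤ 2 * k) :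
    (zigzag s k).boxAt i = (s.1 + i, s.2 + (i % 2 : ℕ)) := by
  simp only [boxAt, zigzag, count_U_take_zigzagWord h, Prod.mk.injEq, true_and]
  push_cast
  ring

theorem mem_boxes_zigzag {s b : Box} {k : ℕ} :
    b ∈ (zigzag s k).boxes ↔ ∃ i ≤ 2 * k, b = (s.1 + (i : ℤ), s.2 + (i % 2 : ℕ)) := by
  have hlength : (zigzag s k).path.toList.length = 2 * k := length_zigzagWord k
  simp only [boxes, hlength, Set.mem_ofPred_eq]
  exact exists_congr fun i => and_congr_right fun hi => by rw [boxAt_zigzag s hi]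

theorem exit_zigzag (s : Box) (k : ℕ) : (zigzag s k).exit = (s.1 + 2 * k, s.2 - 1) := by
  have hlength : (zigzag s k).path.toList.length = 2 * k := length_zigzagWord k
  rw [exit, hlength, boxAt_zigzag s le_rfl]
  simp

theorem exists_eq_zigzag {d : DyckTile} (h : ∀ b ∈ d.boxes, b.2 ≤ d.start.2 + 1) :
    ∃ k, d = zigzag d.start k := by
  have le_one (i : ℕ) :
      (d.path.toList.take i).count DyckStep.U ≤ (d.path.toList.take i).count DyckStep.D + 1 := by
    rcases le_total i d.path.toList.length with hi | hi
    · have := h _ ⟨i, hi, rfl⟩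
      simp only [boxAt] at this
      omega
    · rw [List.take_of_length_le hi, d.path.count_U_eq_count_D]
      omega
  obtain ⟨k, hk⟩ := exists_eq_toList_zigzagWord d.path.toList d.path.count_D_le_count_U le_one
    d.path.count_U_eq_count_D
  exact ⟨k, DyckTile.ext rfl (DyckWord.ext hk)⟩

theorem eq_zigzag_zero {d : DyckTile} (h : ∀ b ∈ d.boxes, b.2 ≤ d.start.2) :
    d = zigzag d.start 0 := by
  obtain ⟨_ | k, hk⟩ := exists_eq_zigzag fun b hb => (h b hb).trans (by omega)
  · exact hk
  · have second : (d.start.1 + (1 : ℕ), d.start.2 + (1 % 2 : ℕ)) ∈ d.boxes := by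
      rw [hk]
      exact mem_boxes_zigzag.2 ⟨1, by omega, rfl⟩
    simpa using h _ second

end DyckTile

/-! ### The boxes of the region and the tiles of a tiling, by rows -/

/-- The box of odd height in row `r` and column `a`. A row of the region consists of the boxes
`lowBox r 0, highBox r 0, lowBox r 1, highBox r 1, …`, from left to right. -/
def lowBox (r a : ℕ) : Box := (2 * (a : ℤ), 2 * (r : ℤ) + 1)

/-- The box of even height between `lowBox r a` and `lowBox r (a + 1)`. -/
def highBox (r a : ℕ) : Box := (2 * (a : ℤ) + 1, 2 * (r : ℤ) + 2)

theorem lowBox_succ (r a : ℕ) : lowBox (r + 1) a = ((lowBox r a).1, (lowBox r a).2 + 2) := by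
  simp only [lowBox, Prod.mk.injEq, true_and]
  omega

theorem highBox_succ (r a : ℕ) :
    highBox (r + 1) a = ((highBox r a).1, (highBox r a).2 + 2) := by
  simp only [highBox, Prod.mk.injEq, true_and]
  omega

theorem lowBox_mem_region {n r a : ℕ} : lowBox r a ∈ region n ↔ a + r < n := by
  refine ⟨fun ⟨_, _, h, _⟩ => ?_, fun h => ⟨?_, ?_, ?_, a + r, ?_⟩⟩ <;>
  simp only [lowBox] at * <;> omega

theorem highBox_mem_region {n r a : ℕ} : highBox r a ∈ region n ↔ a + r + 1 < n := by
  refine ⟨fun ⟨_, _, h, _⟩ => ?_, fun h => ⟨?_, ?_, ?_, a + r + 1, ?_⟩⟩ <;>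
  simp only [highBox] at * <;> omega

theorem exists_eq_lowBox_or_highBox {n : ℕ} {b : Box} (h : b ∈ region n) :
    (∃ r a, b = lowBox r a) ∨ ∃ r a, b = highBox r a := by
  obtain ⟨x, y⟩ := b
  obtain ⟨hx, hy, -, m, hm⟩ := h
  simp only [lowBox, highBox, Prod.mk.injEq] at hx hy hm ⊢
  obtain ⟨a, rfl | rfl⟩ := Int.even_or_odd' x
  · exact Or.inl ⟨(m - a).toNat, a.toNat, by omega, by omega⟩
  · exact Or.inr ⟨(m - a - 1).toNat, a.toNat, by omega, by omega⟩

/-- The tile that consists of the boxes of row `r` from `lowBox r i` to `lowBox r (i + k)`. -/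
def ribbon (r i k : ℕ) : DyckTile := .zigzag (lowBox r i) k

/-- The tile that consists of `highBox r a` only. -/
def single (r a : ℕ) : DyckTile := .zigzag (highBox r a) 0

theorem mem_boxes_ribbon {r i k : ℕ} {b : Box} : b ∈ (ribbon r i k).boxes ↔
    (∃ a, i ≤ a ∧ a ≤ i + k ∧ b = lowBox r a) ∨ ∃ a, i ≤ a ∧ a < i + k ∧ b = highBox r a := by
  obtain ⟨x, y⟩ := b
  simp only [ribbon, DyckTile.mem_boxes_zigzag, lowBox, highBox, Prod.mk.injEq]
  constructor
  · rintro ⟨m, hm, hx, hy⟩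
    obtain ⟨a, rfl | rfl⟩ := Nat.even_or_odd' m
    · exact Or.inl ⟨i + a, by omega⟩
    · exact Or.inr ⟨i + a, by omega⟩
  · rintro (⟨a, h⟩ | ⟨a, h⟩)
    · exact ⟨2 * (a - i), by omega⟩
    · exact ⟨2 * (a - i) + 1, by omega⟩

theorem lowBox_mem_ribbon {r i k s a : ℕ} :
    lowBox s a ∈ (ribbon r i k).boxes ↔ s = r ∧ i ≤ a ∧ a ≤ i + k := by
  simp only [mem_boxes_ribbon, lowBox, highBox, Prod.mk.injEq]
  refine ⟨?_, fun h => Or.inl ⟨a, by omega⟩⟩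
  rintro (⟨a', h⟩ | ⟨a', h⟩) <;> omega

theorem highBox_mem_ribbon {r i k s a : ℕ} :
    highBox s a ∈ (ribbon r i k).boxes ↔ s = r ∧ i ≤ a ∧ a < i + k := by
  simp only [mem_boxes_ribbon, lowBox, highBox, Prod.mk.injEq]
  refine ⟨?_, fun h => Or.inr ⟨a, by omega⟩⟩
  rintro (⟨a', h⟩ | ⟨a', h⟩) <;> omega

theorem mem_boxes_single {r a : ℕ} {b : Box} : b ∈ (single r a).boxes ↔ b = highBox r a := by
  simp [single, DyckTile.mem_boxes_zigzag]

theorem lowBox_notMem_single {r a s b : ℕ} : lowBox s b ∉ (single r a).boxes := by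
  simp only [mem_boxes_single, lowBox, highBox, Prod.mk.injEq]
  omega

theorem highBox_mem_single {r a s b : ℕ} :
    highBox s b ∈ (single r a).boxes ↔ s = r ∧ b = a := by
  simp only [mem_boxes_single, highBox, Prod.mk.injEq]
  omega

theorem boxes_ribbon_subset_region {n r i k : ℕ} (h : i + k + r < n) :
    (ribbon r i k).boxes ⊆ region n := by
  intro b hb
  rcases mem_boxes_ribbon.1 hb with ⟨a, -, ha, rfl⟩ | ⟨a, -, ha, rfl⟩
  · exact lowBox_mem_region.2 (by omega)
  · exact highBox_mem_region.2 (by omega)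

theorem boxes_single_subset_region {n r a : ℕ} (h : a + r + 1 < n) :
    (single r a).boxes ⊆ region n := by
  intro b hb
  rw [mem_boxes_single.1 hb]
  exact highBox_mem_region.2 h

theorem boxes_ribbon_subset_boxes_ribbon {r i k i' k' : ℕ} (hi : i' ≤ i)
    (hik : i + k ≤ i' + k') : (ribbon r i k).boxes ⊆ (ribbon r i' k').boxes := by
  intro b hb
  rcases mem_boxes_ribbon.1 hb with ⟨a, hia, ha, rfl⟩ | ⟨a, hia, ha, rfl⟩
  · exact lowBox_mem_ribbon.2 (by omega)
  · exact highBox_mem_ribbon.2 (by omega)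

theorem moveDown_ribbon_succ (r i k : ℕ) :
    moveDown (ribbon (r + 1) i k).boxes = (ribbon r i k).boxes := by
  simp [DyckTile.moveDown_boxes, ribbon, DyckTile.zigzag, lowBox_succ]

theorem moveDown_single_succ (r a : ℕ) :
    moveDown (single (r + 1) a).boxes = (single r a).boxes := by
  simp [DyckTile.moveDown_boxes, single, DyckTile.zigzag, highBox_succ]

theorem moveDown_ribbon_zero_subset (i k : ℕ) :
    moveDown (ribbon 0 i k).boxes ⊆ belowZigzag := by
  intro b hb
  change (b.1, b.2 + 2) ∈ (ribbon 0 i k).boxes at hb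
  simp only [mem_boxes_ribbon, lowBox, highBox, Prod.mk.injEq] at hb
  change b.2 ≤ 0
  rcases hb with ⟨a, h⟩ | ⟨a, h⟩ <;> omega

theorem moveDown_single_zero_subset (a : ℕ) : moveDown (single 0 a).boxes ⊆ belowZigzag := by
  intro b hb
  change (b.1, b.2 + 2) ∈ (single 0 a).boxes at hb
  simp only [mem_boxes_single, highBox, Prod.mk.injEq] at hb
  change b.2 ≤ 0
  omega

theorem entry_ribbon (r i k : ℕ) :
    (ribbon r i k).entry = (2 * (i : ℤ) - 1, 2 * (r : ℤ) + 1) := rfl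

theorem exit_ribbon (r i k : ℕ) :
    (ribbon r i k).exit = (2 * ((i + k : ℕ) : ℤ), 2 * (r : ℤ)) := by
  simp only [ribbon, DyckTile.exit_zigzag, lowBox, Prod.mk.injEq]
  omega

theorem entry_single (r a : ℕ) : (single r a).entry = (2 * (a : ℤ), 2 * (r : ℤ) + 2) := by
  simp [single, DyckTile.zigzag, DyckTile.entry, highBox]

theorem exit_single (r a : ℕ) :
    (single r a).exit = (2 * (a : ℤ) + 1, 2 * (r : ℤ) + 1) := by
  simp only [single, DyckTile.exit_zigzag, highBox, Prod.mk.injEq]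
  omega

namespace DyckTiling

variable {n : ℕ}

theorem eq_of_mem_boxes (T : DyckTiling n) {d d' : DyckTile} {b : Box} (hd : d ∈ T.tiles)
    (hd' : d' ∈ T.tiles) (hb : b ∈ d.boxes) (hb' : b ∈ d'.boxes) : d = d' :=
  (T.tiling b (T.subset_region d hd hb)).unique ⟨hd, hb⟩ ⟨hd', hb'⟩

theorem row_eq_of_mem_boxes (T : DyckTiling n) {d : DyckTile} {b b' : Box} (hd : d ∈ T.tiles)
    (hb : b ∈ d.boxes) (hb' : b' ∈ d.boxes) : (b.2 + 1) / 2 = (b'.2 + 1) / 2 := by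
  -- Moving a tile down repeatedly keeps it in one tile until it reaches the heights `1` and `2`.
  induction hm : b.2.toNat using Nat.strong_induction_on generalizing d b b' with
  | _ m ih =>
  have hdown (b) (hb : b ∈ d.boxes) : (b.1, b.2 - 2) ∈ moveDown d.boxes := by
    simpa [moveDown] using hb
  obtain ⟨-, hpos, -⟩ := T.subset_region d hd hb
  obtain ⟨-, hpos', -⟩ := T.subset_region d hd hb'
  rcases T.cover_inclusive d hd with ⟨d', hd', hsub⟩ | hsub
  · have := ih _ (by simp only; omega) hd' (hsub (hdown b hb)) (hsub (hdown b' hb')) rfl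
    simp only at this
    omega
  · have hle : b.2 - 2 ≤ 0 := hsub (hdown b hb)
    have hle' : b'.2 - 2 ≤ 0 := hsub (hdown b' hb')
    omega

theorem eq_ribbon_or_single (T : DyckTiling n) {d : DyckTile} (hd : d ∈ T.tiles) :
    (∃ r i k, i + k + r < n ∧ d = ribbon r i k) ∨ ∃ r a, a + r + 1 < n ∧ d = single r a := by
  have hstart := T.subset_region d hd d.start_mem_boxes
  have hrow (b) (hb : b ∈ d.boxes) := T.row_eq_of_mem_boxes hd hb d.start_mem_boxes
  rcases exists_eq_lowBox_or_highBox hstart with ⟨r, i, hs⟩ | ⟨r, a, hs⟩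
  · obtain ⟨k, hk⟩ := DyckTile.exists_eq_zigzag (d := d) fun b hb => by
      have := hrow b hb
      omega
    rw [hs] at hk
    change d = ribbon r i k at hk
    have hlast : lowBox r (i + k) ∈ d.boxes := hk ▸ lowBox_mem_ribbon.2 (by omega)
    exact Or.inl ⟨r, i, k, lowBox_mem_region.1 (T.subset_region d hd hlast), hk⟩
  · have hd0 := DyckTile.eq_zigzag_zero (d := d) fun b hb => by
      have := hrow b hb
      simp only [hs, highBox] at this ⊢
      omega
    rw [hs] at hd0 hstart
    exact Or.inr ⟨r, a, highBox_mem_region.1 hstart, hd0⟩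

end DyckTiling

/-! ### The tiling with a given code -/

/-- The half-open interval `[i, i + k)`, possibly empty, is a maximal interval on which `p` holds:
`p` fails at `i + k` and, if `0 < i`, at `i - 1`. -/
structure IsMaximalRun (p : ℕ → Prop) (i k : ℕ) : Prop where
  not_pred : ∀ b, b + 1 = i → ¬p b
  forall_mem : ∀ b, i ≤ b → b < i + k → p b
  not_last : ¬p (i + k)

namespace IsMaximalRun

variable {p q : ℕ → Prop} {i k i' k' a : ℕ}

theorem exists_of_not_pred (not_pred : ∀ b, b + 1 = i → ¬p b) (h : ∃ b ≥ i, ¬p b) :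
    ∃ k, IsMaximalRun p i k := by
  classical
  have hshift : ∃ k, ¬p (i + k) := by
    obtain ⟨b, hib, hb⟩ := h
    exact ⟨b - i, by rwa [Nat.add_sub_cancel' hib]⟩
  refine ⟨Nat.find hshift, not_pred, fun b hib hb => ?_, Nat.find_spec hshift⟩
  by_contra hpb
  exact Nat.find_min hshift (m := b - i) (by omega) (by rwa [Nat.add_sub_cancel' hib])

theorem exists_of_unbounded (h : ∀ a, ∃ b ≥ a, ¬p b) (a : ℕ) :
    ∃ i k, IsMaximalRun p i k ∧ i ≤ a ∧ a ≤ i + k := by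
  induction a with
  | zero =>
    obtain ⟨k, hk⟩ := exists_of_not_pred (i := 0) (by omega) (h 0)
    exact ⟨0, k, hk, le_rfl, Nat.zero_le _⟩
  | succ a ih =>
    obtain ⟨i, k, hrun, hia, hak⟩ := ih
    rcases hak.lt_or_eq with hak | rfl
    · exact ⟨i, k, hrun, by omega, hak⟩
    · obtain ⟨l, hl⟩ := exists_of_not_pred (i := i + k + 1)
        (fun b hb => (Nat.succ_injective hb) ▸ hrun.not_last) (h _)
      exact ⟨i + k + 1, l, hl, le_rfl, by omega⟩

theorem subset_of_imp (hp : IsMaximalRun p i k) (hq : IsMaximalRun q i' k')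
    (hpq : ∀ b, p b → q b) (hia : i ≤ a) (hak : a ≤ i + k) (hia' : i' ≤ a) (hak' : a ≤ i' + k') :
    i' ≤ i ∧ i + k ≤ i' + k' := by
  constructor
  · by_contra! hlt
    exact hq.not_pred (i' - 1) (by omega) (hpq _ (hp.forall_mem _ (by omega) (by omega)))
  · by_contra! hlt
    exact hq.not_last (hpq _ (hp.forall_mem _ (by omega) (by omega)))

theorem unique (h : IsMaximalRun p i k) (h' : IsMaximalRun p i' k') (hia : i ≤ a)
    (hak : a ≤ i + k) (hia' : i' ≤ a) (hak' : a ≤ i' + k') : i = i' ∧ k = k' := by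
  have := h.subset_of_imp h' (fun _ => id) hia hak hia' hak'
  have := h'.subset_of_imp h (fun _ => id) hia' hak' hia hak
  omega

theorem eq_add_of_not (h : IsMaximalRun p i k) (ha : ¬p a) (hia : i ≤ a) (hak : a ≤ i + k) :
    a = i + k :=
  hak.antisymm (not_lt.1 fun hlt => ha (h.forall_mem a hia hlt))

theorem eq_succ_of_not (h : IsMaximalRun p i k) (ha : ¬p a) (hia : i ≤ a + 1)
    (hak : a + 1 ≤ i + k) : i = a + 1 :=
  hia.antisymm (not_lt.1 fun hlt => ha (h.forall_mem a (Nat.le_of_lt_succ hlt) hak))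

end IsMaximalRun

/-- The sequences that encode tilings. In the tiling with code `c`, the boxes `lowBox r b` and
`lowBox r (b + 1)` lie in the same tile if and only if `r < c b`, which is possible only if
`highBox r b` belongs to the region. -/
def IsCode (n : ℕ) (c : ℕ → ℕ) : Prop := ∀ b r, r < c b → b + r + 1 < n

section CodeTiling

variable {n : ℕ} {c : ℕ → ℕ}

theorem IsCode.exists_isMaximalRun (hc : IsCode n c) (r a : ℕ) :
    ∃ i k, IsMaximalRun (r < c ·) i k ∧ i ≤ a ∧ a ≤ i + k :=
  IsMaximalRun.exists_of_unbounded
    (fun b => ⟨b + n, Nat.le_add_right b n, fun h => by have := hc _ _ h; omega⟩) a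

theorem IsCode.add_add_lt (hc : IsCode n c) {r i k : ℕ} (hrun : IsMaximalRun (r < c ·) i k)
    (h : i + r < n) : i + k + r < n := by
  rcases k with _ | k
  · exact h
  · have := hc _ _ (hrun.forall_mem (i + k) (by omega) (by omega))
    omega

open Classical in
/-- The tiles of the tiling with code `c`. -/
noncomputable def codeTiles (n : ℕ) (c : ℕ → ℕ) : Finset DyckTile :=
  ((range n ×ˢ range n ×ˢ range n).filter fun (r, i, k) =>
      i + k + r < n ∧ IsMaximalRun (r < c ·) i k).image (fun (r, i, k) => ribbon r i k)
    ∪ ((range n ×ˢ range n).filter fun (r, b) => b + r + 1 < n ∧ c b ≤ r).image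
      (fun (r, b) => single r b)

theorem mem_codeTiles {d : DyckTile} : d ∈ codeTiles n c ↔
    (∃ r i k, i + k + r < n ∧ IsMaximalRun (r < c ·) i k ∧ d = ribbon r i k) ∨
    (∃ r b, b + r + 1 < n ∧ c b ≤ r ∧ d = single r b) := by
  simp only [codeTiles, mem_union, mem_image, mem_filter, mem_product, mem_range, Prod.exists]
  refine or_congr (exists₃_congr fun r i k => ?_) (exists₂_congr fun r b => ?_)
  · rw [eq_comm (a := d), ← and_assoc (c := ribbon r i k = d)]
    exact and_congr_left fun _ => and_iff_right_of_imp fun h => by omega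
  · rw [eq_comm (a := d), ← and_assoc (c := single r b = d)]
    exact and_congr_left fun _ => and_iff_right_of_imp fun h => by omega

theorem exists_ribbon_mem_codeTiles (hc : IsCode n c) {r a : ℕ} (h : a + r < n) :
    ∃ i k, ribbon r i k ∈ codeTiles n c ∧ IsMaximalRun (r < c ·) i k ∧ i ≤ a ∧ a ≤ i + k := by
  obtain ⟨i, k, hrun, hia, hak⟩ := hc.exists_isMaximalRun r a
  exact ⟨i, k, mem_codeTiles.2 (Or.inl ⟨r, i, k, hc.add_add_lt hrun (by omega), hrun, rfl⟩),
    hrun, hia, hak⟩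

theorem exists_eq_ribbon_of_lowBox_mem {d : DyckTile} {r a : ℕ} (hd : d ∈ codeTiles n c)
    (h : lowBox r a ∈ d.boxes) :
    ∃ i k, d = ribbon r i k ∧ IsMaximalRun (r < c ·) i k ∧ i ≤ a ∧ a ≤ i + k := by
  rcases mem_codeTiles.1 hd with ⟨r', i, k, -, hrun, rfl⟩ | ⟨r', b, -, -, rfl⟩
  · obtain ⟨rfl, hia, hak⟩ := lowBox_mem_ribbon.1 h
    exact ⟨i, k, rfl, hrun, hia, hak⟩
  · exact absurd h lowBox_notMem_single

theorem highBox_mem_iff_lowBox_mem {d : DyckTile} {r a : ℕ} (hd : d ∈ codeTiles n c)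
    (hr : r < c a) : highBox r a ∈ d.boxes ↔ lowBox r a ∈ d.boxes := by
  rcases mem_codeTiles.1 hd with ⟨r', i, k, -, hrun, rfl⟩ | ⟨r', b, -, hb, rfl⟩
  · rw [highBox_mem_ribbon, lowBox_mem_ribbon]
    refine ⟨fun h => by omega, fun ⟨hrr', hia, hak⟩ => ⟨hrr', hia, hak.lt_of_ne ?_⟩⟩
    rintro rfl
    exact hrun.not_last (hrr' ▸ hr)
  · refine iff_of_false (fun h => ?_) lowBox_notMem_single
    obtain ⟨rfl, rfl⟩ := highBox_mem_single.1 h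
    omega

theorem eq_single_of_highBox_mem {d : DyckTile} {r a : ℕ} (hd : d ∈ codeTiles n c)
    (hr : c a ≤ r) (h : highBox r a ∈ d.boxes) : d = single r a := by
  rcases mem_codeTiles.1 hd with ⟨r', i, k, -, hrun, rfl⟩ | ⟨r', b, -, -, rfl⟩
  · obtain ⟨rfl, hia, hak⟩ := highBox_mem_ribbon.1 h
    exact absurd (hrun.forall_mem a hia hak) (by omega)
  · obtain ⟨rfl, rfl⟩ := highBox_mem_single.1 h
    rfl

theorem existsUnique_lowBox_mem (hc : IsCode n c) {r a : ℕ} (h : a + r < n) :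
    ∃! d, d ∈ codeTiles n c ∧ lowBox r a ∈ d.boxes := by
  obtain ⟨i, k, hd, hrun, hia, hak⟩ := exists_ribbon_mem_codeTiles hc h
  refine ⟨ribbon r i k, ⟨hd, lowBox_mem_ribbon.2 ⟨rfl, hia, hak⟩⟩, fun d' ⟨hd', ha⟩ => ?_⟩
  obtain ⟨i', k', rfl, hrun', hia', hak'⟩ := exists_eq_ribbon_of_lowBox_mem hd' ha
  obtain ⟨rfl, rfl⟩ := hrun.unique hrun' hia hak hia' hak'
  rfl

theorem existsUnique_highBox_mem (hc : IsCode n c) {r a : ℕ} (h : a + r + 1 < n) :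
    ∃! d, d ∈ codeTiles n c ∧ highBox r a ∈ d.boxes := by
  rcases lt_or_ge r (c a) with hr | hr
  · exact (existsUnique_congr fun d => and_congr_right fun hd =>
      highBox_mem_iff_lowBox_mem hd hr).2 (existsUnique_lowBox_mem hc (by omega))
  · exact ⟨single r a, ⟨mem_codeTiles.2 (Or.inr ⟨r, a, h, hr, rfl⟩),
      highBox_mem_single.2 ⟨rfl, rfl⟩⟩, fun d' hd' => eq_single_of_highBox_mem hd'.1 hr hd'.2⟩

theorem existsUnique_mem_codeTiles (hc : IsCode n c) {b : Box} (hb : b ∈ region n) :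
    ∃! d, d ∈ codeTiles n c ∧ b ∈ d.boxes := by
  rcases exists_eq_lowBox_or_highBox hb with ⟨r, a, rfl⟩ | ⟨r, a, rfl⟩
  · exact existsUnique_lowBox_mem hc (lowBox_mem_region.1 hb)
  · exact existsUnique_highBox_mem hc (highBox_mem_region.1 hb)

theorem boxes_subset_region_of_mem_codeTiles {d : DyckTile} (hd : d ∈ codeTiles n c) :
    d.boxes ⊆ region n := by
  rcases mem_codeTiles.1 hd with ⟨r, i, k, h, -, rfl⟩ | ⟨r, a, h, -, rfl⟩
  · exact boxes_ribbon_subset_region h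
  · exact boxes_single_subset_region h

theorem codeTiles_cover_inclusive (hc : IsCode n c) {d : DyckTile} (hd : d ∈ codeTiles n c) :
    (∃ d' ∈ codeTiles n c, moveDown d.boxes ⊆ d'.boxes) ∨ moveDown d.boxes ⊆ belowZigzag := by
  rcases mem_codeTiles.1 hd with ⟨_ | r, i, k, h, hrun, rfl⟩ | ⟨_ | r, a, h, -, rfl⟩
  · exact Or.inr (moveDown_ribbon_zero_subset i k)
  · obtain ⟨i', k', hmem, hrun', hi, hik⟩ :=
      exists_ribbon_mem_codeTiles hc (r := r) (a := i) (by omega)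
    obtain ⟨hle, hle'⟩ := hrun.subset_of_imp hrun' (fun b => Nat.lt_of_succ_lt) le_rfl
      (Nat.le_add_right i k) hi hik
    rw [moveDown_ribbon_succ]
    exact Or.inl ⟨_, hmem, boxes_ribbon_subset_boxes_ribbon hle hle'⟩
  · exact Or.inr (moveDown_single_zero_subset a)
  · obtain ⟨d, ⟨hd, hmem⟩, -⟩ := existsUnique_highBox_mem hc (r := r) (a := a) (by omega)
    rw [moveDown_single_succ]
    exact Or.inl ⟨d, hd, fun b hb => mem_boxes_single.1 hb ▸ hmem⟩

/-- The tiling with code `c`. -/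
noncomputable def codeTiling (hc : IsCode n c) : DyckTiling n where
  tiles := codeTiles n c
  subset_region _ := boxes_subset_region_of_mem_codeTiles
  tiling _ := existsUnique_mem_codeTiles hc
  cover_inclusive _ := codeTiles_cover_inclusive hc

/-- The pairs `(b, r)` for which `lowBox r b` and `lowBox r (b + 1)` lie in the same tile of the
tiling with code `c`. -/
def links (n : ℕ) (c : ℕ → ℕ) : Finset (Σ _ : ℕ, ℕ) := (range n).sigma fun b => range (c b)

theorem mem_links (hc : IsCode n c) {p : Σ _ : ℕ, ℕ} : p ∈ links n c ↔ p.2 < c p.1 := by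
  simp only [links, mem_sigma, mem_range, and_iff_right_iff_imp]
  intro h
  have := hc _ _ h
  omega

open Classical in
theorem card_filter_links (hc : IsCode n c) {d : DyckTile} (hd : d ∈ codeTiles n c) :
    #{p ∈ links n c | highBox p.2 p.1 ∈ d.boxes} = d.size := by
  rcases mem_codeTiles.1 hd with ⟨r, i, k, -, hrun, rfl⟩ | ⟨r, a, -, ha, rfl⟩
  · have : {p ∈ links n c | highBox p.2 p.1 ∈ (ribbon r i k).boxes}
        = (Ico i (i + k)).image fun b => (⟨b, r⟩ : Σ _ : ℕ, ℕ) := by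
      ext ⟨b, s⟩
      simp only [mem_filter, mem_links hc, highBox_mem_ribbon, mem_image, mem_Ico, Sigma.mk.injEq,
        heq_eq_eq]
      constructor
      · rintro ⟨-, rfl, hb⟩
        exact ⟨b, hb, rfl, rfl⟩
      · rintro ⟨b, hb, rfl, rfl⟩
        exact ⟨hrun.forall_mem b hb.1 hb.2, rfl, hb⟩
    rw [this, card_image_of_injective _ fun x y h => congrArg Sigma.fst h, Nat.card_Ico, ribbon,
      DyckTile.size_zigzag, Nat.add_sub_cancel_left]
  · rw [single, DyckTile.size_zigzag, card_eq_zero, filter_eq_empty_iff]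
    rintro ⟨b, s⟩ hp hmem
    obtain ⟨rfl, rfl⟩ := highBox_mem_single.1 hmem
    exact absurd ((mem_links hc).1 hp) (by simpa using ha)

-- Both sides count the high boxes that lie in ribbons.
theorem weight_codeTiling (hc : IsCode n c) :
    (codeTiling hc).weight = ∑ b ∈ range n, c b := by
  classical
  have card_tiles : ∀ p ∈ links n c, #{d ∈ codeTiles n c | highBox p.2 p.1 ∈ d.boxes} = 1 := by
    intro p hp
    obtain ⟨d, hd, hunique⟩ := existsUnique_highBox_mem hc (hc _ _ ((mem_links hc).1 hp))
    exact card_eq_one.2 ⟨d, by ext e; simpa using ⟨hunique e, fun h => h ▸ hd⟩⟩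
  have double_count :=
    sum_card_bipartiteAbove_eq_sum_card_bipartiteBelow (s := codeTiles n c) (t := links n c)
      fun d p => highBox p.2 p.1 ∈ d.boxes
  simp only [bipartiteAbove, bipartiteBelow, sum_congr rfl card_tiles,
    sum_congr rfl fun d => card_filter_links hc (d := d)] at double_count
  rw [DyckTiling.weight, codeTiling, double_count, ← card_eq_sum_ones, links, card_sigma]
  simp only [card_range]

end CodeTiling

namespace DyckTiling

variable {n : ℕ} {T : DyckTiling n} {r b : ℕ}

/-- The boxes `lowBox r b` and `lowBox r (b + 1)` lie in the same tile. -/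
def Linked (T : DyckTiling n) (r b : ℕ) : Prop :=
  ∃ d ∈ T.tiles, lowBox r b ∈ d.boxes ∧ lowBox r (b + 1) ∈ d.boxes

theorem Linked.add_lt (h : T.Linked r b) : b + r + 1 < n := by
  obtain ⟨d, hd, -, h⟩ := h
  have := lowBox_mem_region.1 (T.subset_region d hd h)
  omega

theorem Linked.of_succ (h : T.Linked (r + 1) b) : T.Linked r b := by
  obtain ⟨d, hd, hb, hb'⟩ := h
  have hdown {a : ℕ} (ha : lowBox (r + 1) a ∈ d.boxes) : lowBox r a ∈ moveDown d.boxes := by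
    rwa [lowBox_succ] at ha
  rcases T.cover_inclusive d hd with ⟨d', hd', hsub⟩ | hsub
  · exact ⟨d', hd', hsub (hdown hb), hsub (hdown hb')⟩
  · have : 2 * (r : ℤ) + 1 ≤ 0 := hsub (hdown hb)
    omega

theorem antitone_linked (T : DyckTiling n) (b : ℕ) : Antitone (T.Linked · b) :=
  antitone_nat_of_succ_le fun _ => Linked.of_succ

theorem exists_not_linked (T : DyckTiling n) (b : ℕ) : ∃ r, ¬T.Linked r b :=
  ⟨n, fun h => by have := h.add_lt; omega⟩

open Classical in
/-- The code of a tiling: the number of rows in which there is a link at a given column. -/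
noncomputable def code (T : DyckTiling n) (b : ℕ) : ℕ := Nat.find (T.exists_not_linked b)

theorem lt_code : r < T.code b ↔ T.Linked r b := by
  classical
  rw [code, Nat.lt_find_iff]
  exact ⟨fun h => not_not.1 (h r le_rfl), fun h s hs => not_not.2 (T.antitone_linked b hs h)⟩

theorem isCode_code (T : DyckTiling n) : IsCode n T.code := fun _ _ h => (lt_code.1 h).add_lt

theorem linked_iff_lowBox_succ_mem {d : DyckTile} (hd : d ∈ T.tiles) (h : lowBox r b ∈ d.boxes) :
    T.Linked r b ↔ lowBox r (b + 1) ∈ d.boxes :=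
  ⟨fun ⟨_, hd', hb, hb'⟩ => T.eq_of_mem_boxes hd' hd hb h ▸ hb', fun h' => ⟨d, hd, h, h'⟩⟩

theorem linked_iff_lowBox_mem {d : DyckTile} (hd : d ∈ T.tiles)
    (h : lowBox r (b + 1) ∈ d.boxes) : T.Linked r b ↔ lowBox r b ∈ d.boxes :=
  ⟨fun ⟨_, hd', hb, hb'⟩ => T.eq_of_mem_boxes hd' hd hb' h ▸ hb, fun h' => ⟨d, hd, h', h⟩⟩

theorem isMaximalRun_of_ribbon_mem {i k : ℕ} (hd : ribbon r i k ∈ T.tiles) :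
    IsMaximalRun (r < T.code ·) i k where
  not_pred := by
    rintro b rfl
    rw [lt_code, linked_iff_lowBox_mem hd (lowBox_mem_ribbon.2 (by omega)), lowBox_mem_ribbon]
    omega
  forall_mem b hib hb := by
    rw [lt_code, linked_iff_lowBox_mem hd (lowBox_mem_ribbon.2 (by omega)), lowBox_mem_ribbon]
    omega
  not_last := by
    rw [lt_code, linked_iff_lowBox_succ_mem hd (lowBox_mem_ribbon.2 (by omega)), lowBox_mem_ribbon]
    omega

theorem Linked.single_notMem (h : T.Linked r b) : single r b ∉ T.tiles := by
  intro hsingle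
  obtain ⟨d, hd, hb, hb'⟩ := h
  rcases T.eq_ribbon_or_single hd with ⟨r', i, k, -, rfl⟩ | ⟨r', a, -, rfl⟩
  · have hhigh : highBox r b ∈ (ribbon r' i k).boxes := by
      rw [lowBox_mem_ribbon] at hb hb'
      exact highBox_mem_ribbon.2 (by omega)
    have heq := T.eq_of_mem_boxes hd hsingle hhigh (highBox_mem_single.2 ⟨rfl, rfl⟩)
    exact lowBox_notMem_single (heq ▸ hb)
  · exact lowBox_notMem_single hb

theorem tiles_subset_codeTiles (T : DyckTiling n) : T.tiles ⊆ codeTiles n T.code := by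
  intro d hd
  rcases T.eq_ribbon_or_single hd with ⟨r, i, k, h, rfl⟩ | ⟨r, b, h, rfl⟩
  · exact mem_codeTiles.2 (Or.inl ⟨r, i, k, h, isMaximalRun_of_ribbon_mem hd, rfl⟩)
  · exact mem_codeTiles.2 (Or.inr
      ⟨r, b, h, not_lt.1 fun hlt => (lt_code.1 hlt).single_notMem hd, rfl⟩)

theorem eq_of_tiles_subset {T T' : DyckTiling n} (h : T.tiles ⊆ T'.tiles) : T = T' := by
  refine DyckTiling.ext (h.antisymm fun d hd => ?_)
  obtain ⟨d', ⟨hd', hstart⟩, -⟩ := T.tiling d.start (T'.subset_region d hd d.start_mem_boxes)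
  rwa [T'.eq_of_mem_boxes hd (h hd') d.start_mem_boxes hstart]

theorem eq_codeTiling (T : DyckTiling n) : T = codeTiling T.isCode_code :=
  eq_of_tiles_subset T.tiles_subset_codeTiles

end DyckTiling

/-! ### Trajectories -/

namespace DyckTiling

variable {n : ℕ} {T : DyckTiling n}

/-- A trajectory of `T` that leaves the tile `e` at its exit enters the tile `e'`. -/
def Follows (T : DyckTiling n) (e e' : DyckTile) : Prop := e' ∈ T.tiles ∧ e.exit = e'.entry

theorem eq_of_entry_eq (T : DyckTiling n) {d d' : DyckTile} (hd : d ∈ T.tiles)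
    (hd' : d' ∈ T.tiles) (h : d.entry = d'.entry) : d = d' := by
  have hstart : d.start = d'.start := by
    simp only [DyckTile.entry, Prod.mk.injEq] at h
    exact Prod.ext (by omega) h.2
  exact T.eq_of_mem_boxes hd hd' d.start_mem_boxes (hstart ▸ d'.start_mem_boxes)

theorem rightUnique_follows (T : DyckTiling n) : Relator.RightUnique T.Follows :=
  fun _ _ _ h h' => T.eq_of_entry_eq h.1 h'.1 (h.2.symm.trans h'.2)

theorem eq_of_reflTransGen_follows {d d' : DyckTile} (hlast : ∀ e ∈ T.tiles, d.exit ≠ e.entry)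
    (h : Relation.ReflTransGen T.Follows d d') : d = d' := by
  rcases h.cases_head with h | ⟨e, ⟨he, hexit⟩, -⟩
  · exact h
  · exact absurd hexit (hlast e he)

theorem TrajectoryEndsAt.unique {i : Fin n} {u u' : UpStep}
    (h : T.TrajectoryEndsAt i u) (h' : T.TrajectoryEndsAt i u') : u = u' := by
  obtain ⟨d₀, hd₀, d, -, hstart, hpath, hlast, rfl⟩ := h
  obtain ⟨d₀', hd₀', d', -, hstart', hpath', hlast', rfl⟩ := h'
  obtain rfl : d₀ = d₀' := T.eq_of_mem_boxes hd₀ hd₀' d₀.start_mem_boxes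
    (hstart.trans hstart'.symm ▸ d₀'.start_mem_boxes)
  rcases Relation.ReflTransGen.total_of_right_unique T.rightUnique_follows hpath hpath' with h | h
  · rw [eq_of_reflTransGen_follows hlast h]
  · rw [eq_of_reflTransGen_follows hlast' h]

theorem peakX_injective : Function.Injective (peakX n) := fun i j h => by
  simp only [peakX] at h
  exact Fin.ext (by omega)

theorem Corresponds.unique {w w' : Equiv.Perm (Fin n)}
    (h : T.Corresponds w) (h' : T.Corresponds w') : w = w' := by
  refine Equiv.ext fun j => ?_
  obtain ⟨u, hu, hj⟩ := h j
  obtain ⟨u', hu', hj'⟩ := h' (w'.symm (w j))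
  rw [w'.apply_symm_apply] at hu'
  obtain rfl := hu.unique hu'
  exact (Equiv.eq_symm_apply _).1 (peakX_injective (hj.symm.trans hj')) |>.symm

theorem anchorBox_eq_lowBox (i : Fin n) : anchorBox n i = lowBox i.rev 0 := by
  simp only [anchorBox, lowBox, Fin.val_rev, Prod.mk.injEq]
  omega

end DyckTiling

/-- One step of a trajectory in the tiling with code `c`, from a column of boxes of odd height to
the next one: the pair `(r, b)` stands for a visit to the tile that contains `lowBox r b`. In a
step `drop`, the trajectory runs through the tile `single r b`. -/
inductive TrackStep (c : ℕ → ℕ) : ℕ × ℕ → ℕ × ℕ → Prop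
  | stay {r b : ℕ} : r < c b → TrackStep c (r, b) (r, b + 1)
  | drop {r b : ℕ} : c b ≤ r → TrackStep c (r + 1, b) (r, b + 1)

section Trajectory

open Relation (ReflTransGen)

variable {n : ℕ} {c : ℕ → ℕ}

theorem TrackStep.exists_reflTransGen_follows (hc : IsCode n c) {p q : ℕ × ℕ}
    (h : TrackStep c p q) {d : DyckTile} (hd : d ∈ codeTiles n c) (hp : lowBox p.1 p.2 ∈ d.boxes) :
    ∃ d' ∈ codeTiles n c, lowBox q.1 q.2 ∈ d'.boxes ∧
      ReflTransGen (codeTiling hc).Follows d d' := by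
  rcases h with @⟨r, b, hrb⟩ | @⟨r, b, hrb⟩
  · obtain ⟨i, k, rfl, hrun, hib, hbk⟩ := exists_eq_ribbon_of_lowBox_mem (r := r) (a := b) hd hp
    have hne : b ≠ i + k := by
      rintro rfl
      exact hrun.not_last hrb
    exact ⟨_, hd, lowBox_mem_ribbon.2 ⟨rfl, by simp only; omega⟩, .refl⟩
  · obtain ⟨i, k, rfl, hrun, hib, hbk⟩ :=
      exists_eq_ribbon_of_lowBox_mem (r := r + 1) (a := b) hd hp
    have hregion : b + (r + 1) < n :=
      lowBox_mem_region.1 (boxes_subset_region_of_mem_codeTiles hd hp)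
    obtain ⟨i', k', hd', hrun', hi', hk'⟩ :=
      exists_ribbon_mem_codeTiles hc (r := r) (a := b + 1) (by omega)
    obtain rfl := hrun'.eq_succ_of_not hrb.not_gt hi' hk'
    obtain rfl := hrun.eq_add_of_not (not_lt.2 (hrb.trans r.le_succ)) hib hbk
    have hsingle : single r (i + k) ∈ codeTiles n c :=
      mem_codeTiles.2 (Or.inr ⟨r, i + k, by omega, hrb, rfl⟩)
    refine ⟨_, hd', lowBox_mem_ribbon.2 ⟨rfl, hi', hk'⟩, .head ⟨hsingle, ?_⟩ (.single ⟨hd', ?_⟩)⟩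
    · simp only [exit_ribbon, entry_single, Prod.mk.injEq, true_and]
      omega
    · simp only [exit_single, entry_ribbon, Prod.mk.injEq, and_true]
      omega

theorem exists_reflTransGen_follows_of_track (hc : IsCode n c) {p q : ℕ × ℕ}
    (h : ReflTransGen (TrackStep c) p q) {d : DyckTile} (hd : d ∈ codeTiles n c)
    (hp : lowBox p.1 p.2 ∈ d.boxes) :
    ∃ d' ∈ codeTiles n c, lowBox q.1 q.2 ∈ d'.boxes ∧
      ReflTransGen (codeTiling hc).Follows d d' := by
  induction h with
  | refl => exact ⟨d, hd, hp, .refl⟩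
  | tail _ hstep ih =>
    obtain ⟨e, he, hmem, hpath⟩ := ih
    obtain ⟨d', hd', hmem', hpath'⟩ := hstep.exists_reflTransGen_follows hc he hmem
    exact ⟨d', hd', hmem', hpath.trans hpath'⟩

theorem entry_ne_of_mem_codeTiles {d : DyckTile} (hd : d ∈ codeTiles n c) (t : ℕ) :
    d.entry ≠ (2 * (t : ℤ), 2 * (c t : ℤ)) := by
  rcases mem_codeTiles.1 hd with ⟨r, i, k, -, -, rfl⟩ | ⟨r, a, -, ha, rfl⟩
  · simp only [entry_ribbon, ne_eq, Prod.mk.injEq]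
    omega
  · simp only [entry_single, ne_eq, Prod.mk.injEq]
    rintro ⟨hx, hy⟩
    obtain rfl : a = t := by omega
    omega

theorem codeTiling_trajectoryEndsAt (hc : IsCode n c) (i : Fin n) {t : ℕ}
    (h : ReflTransGen (TrackStep c) (↑i.rev, 0) (c t, t)) :
    (codeTiling hc).TrajectoryEndsAt i (2 * (t : ℤ), 2 * (c t : ℤ)) := by
  obtain ⟨d₀, ⟨hd₀, hanchor⟩, -⟩ :=
    existsUnique_lowBox_mem hc (r := i.rev) (a := 0) (by omega)
  obtain ⟨d, hd, hmem, hpath⟩ := exists_reflTransGen_follows_of_track hc h hd₀ hanchor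
  have hstart : d₀.start = DyckTiling.anchorBox n i := by
    obtain ⟨i', k, rfl, -, hi', -⟩ := exists_eq_ribbon_of_lowBox_mem hd₀ hanchor
    rw [DyckTiling.anchorBox_eq_lowBox, Nat.le_zero.1 hi']
    rfl
  have hexit : d.exit = (2 * (t : ℤ), 2 * (c t : ℤ)) := by
    obtain ⟨i', k, rfl, hrun, hi', hik⟩ := exists_eq_ribbon_of_lowBox_mem hd hmem
    obtain rfl := hrun.eq_add_of_not (lt_irrefl _) hi' hik
    exact exit_ribbon _ _ _
  exact ⟨d₀, hd₀, d, hd, hstart, hpath,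
    fun d' hd' h => entry_ne_of_mem_codeTiles hd' t (h.symm.trans hexit), hexit.symm⟩

end Trajectory

/-! ### Inversions of a sequence -/

section Inversions

variable {ι α : Type*} [LinearOrder ι] [LocallyFiniteOrderBot ι] [LinearOrder α] {f : ι → α}

/-- The number of greater terms before the `i`-th term of the sequence `f`. -/
def greaterBefore (f : ι → α) (i : ι) : ℕ := #{k ∈ Iio i | f i < f k}

/-- The number of smaller terms before the `i`-th term of the sequence `f`. -/
def smallerBefore (f : ι → α) (i : ι) : ℕ := #{k ∈ Iio i | f k < f i}

theorem greaterBefore_le (f : ι → α) (i : ι) : greaterBefore f i ≤ #(Iio i) := card_filter_le _ _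

theorem smallerBefore_le (f : ι → α) (i : ι) : smallerBefore f i ≤ #(Iio i) := card_filter_le _ _

theorem greaterBefore_add_smallerBefore (hf : f.Injective) (i : ι) :
    greaterBefore f i + smallerBefore f i = #(Iio i) := by
  have hsmaller : {k ∈ Iio i | f k < f i} = {k ∈ Iio i | ¬f i < f k} :=
    filter_congr fun k hk => by
      rw [not_lt, (hf.ne (mem_Iio.1 hk).ne).le_iff_lt]
  rw [greaterBefore, smallerBefore, hsmaller, card_filter_add_card_filter_not]

theorem smallerBefore_lt_of_isLeast {i j k : ι} (hij : i < j) (hfij : f i < f j)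
    (hk : IsLeast {k | j < k ∧ f k < f i} k) : smallerBefore f k < smallerBefore f j := by
  obtain ⟨⟨-, hfki⟩, hleast⟩ := hk
  refine card_lt_card (ssubset_iff_of_subset (fun l hl => ?_) |>.2 ⟨i, ?_, ?_⟩)
  · obtain ⟨hlk, hflk⟩ : l < k ∧ f l < f k := by simpa using hl
    have hlj : l < j := by
      refine lt_of_not_ge fun hjl => ?_
      rcases hjl.lt_or_eq with hjl | rfl
      · exact hlk.not_ge (hleast ⟨hjl, hflk.trans hfki⟩)
      · exact (hflk.trans hfki).not_gt hfij
    simpa using ⟨hlj, hflk.trans (hfki.trans hfij)⟩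
  · simpa using ⟨hij, hfij⟩
  · simpa using fun _ => hfki.le

theorem monotone_smallerBefore_iff (hf : f.Injective) : Monotone (smallerBefore f) ↔
    ∀ i j k, i < j → j < k → ¬(f k < f i ∧ f i < f j) := by
  constructor
  · rintro hmono i j k hij hjk ⟨hki, hfij⟩
    let s : Finset ι := {m ∈ Iic k | j < m ∧ f m < f i}
    have hks : k ∈ s := by simpa [s] using ⟨hjk, hki⟩
    have hmem : s.min' ⟨k, hks⟩ ∈ s := s.min'_mem _
    have hleast : IsLeast {m | j < m ∧ f m < f i} (s.min' ⟨k, hks⟩) := by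
      refine ⟨(mem_filter.1 hmem).2, fun l hl => ?_⟩
      rcases le_total l k with hlk | hkl
      · exact s.min'_le l (mem_filter.2 ⟨mem_Iic.2 hlk, hl⟩)
      · exact (s.min'_le k hks).trans hkl
    exact (hmono hleast.1.1.le).not_gt (smallerBefore_lt_of_isLeast hij hfij hleast)
  · intro havoid j k hjk
    rcases hjk.eq_or_lt with rfl | hjk
    · exact le_rfl
    refine card_le_card fun i hi => ?_
    obtain ⟨hij, hfij⟩ : i < j ∧ f i < f j := by simpa using hi
    have hfik : f i < f k :=
      (not_lt.1 fun hki => havoid i j k hij hjk ⟨hki, hfij⟩).lt_of_ne (hf.ne (hij.trans hjk).ne)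
    simpa using ⟨hij.trans hjk, hfik⟩

end Inversions

section InversionCode

variable {n : ℕ} {α : Type*} [LinearOrder α] {f : Fin n → α}

/-- The number of greater terms before the `b`-th term from the right, as a function of `b`. -/
def inversionCode (f : Fin n → α) (b : ℕ) : ℕ :=
  if h : b < n then greaterBefore f (Fin.rev ⟨b, h⟩) else 0

theorem inversionCode_rev (f : Fin n → α) (m : Fin n) :
    inversionCode f m.rev = greaterBefore f m := by
  rw [inversionCode, dif_pos m.rev.isLt, Fin.eta, Fin.rev_rev]

theorem exists_val_rev_eq {b : ℕ} (hb : b < n) : ∃ m : Fin n, (m.rev : ℕ) = b :=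
  ⟨Fin.rev ⟨b, hb⟩, by rw [Fin.rev_rev]⟩

theorem isCode_inversionCode (f : Fin n → α) : IsCode n (inversionCode f) := by
  intro b r hr
  rcases lt_or_ge b n with hb | hb
  · obtain ⟨m, rfl⟩ := exists_val_rev_eq hb
    have hle := greaterBefore_le f m
    rw [inversionCode_rev] at hr
    rw [Fin.card_Iio] at hle
    rw [Fin.val_rev]
    omega
  · rw [inversionCode, dif_neg hb.not_gt] at hr
    omega

/-- The number of terms greater than `v` among the first `n - b` terms of `f`. This is the row in
which the trajectory of the label `v` passes column `b` if `f` is a permutation. -/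
def trackRow (f : Fin n → α) (v : α) (b : ℕ) : ℕ := #{k : Fin n | (k : ℕ) + b < n ∧ v < f k}

theorem trackRow_rev (f : Fin n → α) (v : α) (m : Fin n) :
    trackRow f v m.rev = #{k ∈ Iic m | v < f k} := by
  refine congrArg card (ext fun k => ?_)
  simp only [mem_filter, mem_univ, true_and, mem_Iic, Fin.val_rev, Fin.le_def]
  exact and_congr_left fun _ => by omega

theorem trackRow_rev_add_one (f : Fin n → α) (v : α) (m : Fin n) :
    trackRow f v (m.rev + 1) = #{k ∈ Iio m | v < f k} := by
  refine congrArg card (ext fun k => ?_)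
  simp only [mem_filter, mem_univ, true_and, mem_Iio, Fin.val_rev, Fin.lt_def]
  exact and_congr_left fun _ => by omega

theorem trackRow_rev_self (f : Fin n → α) (j : Fin n) :
    trackRow f (f j) j.rev = inversionCode f j.rev := by
  rw [trackRow_rev, inversionCode_rev, greaterBefore, ← Iio_insert, filter_insert,
    if_neg (lt_irrefl _)]

theorem trackStep_trackRow (hf : f.Injective) {j m : Fin n} (hjm : j < m) :
    TrackStep (inversionCode f) (trackRow f (f j) m.rev, m.rev)
      (trackRow f (f j) (m.rev + 1), m.rev + 1) := by
  have hrow : trackRow f (f j) m.rev =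
      trackRow f (f j) (m.rev + 1) + if f j < f m then 1 else 0 := by
    rw [trackRow_rev, trackRow_rev_add_one, ← Iio_insert, filter_insert]
    split_ifs
    · rw [card_insert_of_notMem (by simp)]
    · rfl
  rcases (hf.ne hjm.ne).lt_or_gt with hlt | hgt
  · rw [hrow, if_pos hlt]
    refine .drop ?_
    rw [trackRow_rev_add_one, inversionCode_rev]
    exact card_le_card (monotone_filter_right _ fun k _ hk => hlt.trans hk)
  · rw [hrow, if_neg hgt.not_gt, add_zero]
    refine .stay ?_
    rw [trackRow_rev_add_one, inversionCode_rev]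
    refine card_lt_card (ssubset_iff_of_subset
      (monotone_filter_right _ fun k _ hk => hgt.trans hk) |>.2 ⟨j, ?_, ?_⟩)
    · simpa using ⟨hjm, hgt⟩
    · simp

theorem reflTransGen_trackStep_trackRow (hf : f.Injective) {j : Fin n} {b : ℕ} (hb : b ≤ j.rev) :
    Relation.ReflTransGen (TrackStep (inversionCode f)) (trackRow f (f j) 0, 0)
      (trackRow f (f j) b, b) := by
  induction b with
  | zero => exact .refl
  | succ b ih =>
    obtain ⟨m, rfl⟩ := exists_val_rev_eq (hb.trans_lt j.rev.isLt |>.le)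
    exact (ih (Nat.le_of_succ_le hb)).tail (trackStep_trackRow hf (Fin.rev_lt_rev.1 hb))

end InversionCode

/-! ### The tiling of a permutation -/

section PermTiling

variable {n : ℕ}

/-- The tiling that corresponds to the permutation `w`. -/
noncomputable def permTiling (w : Equiv.Perm (Fin n)) : DyckTiling n :=
  codeTiling (isCode_inversionCode w)

theorem trackRow_perm_zero (w : Equiv.Perm (Fin n)) (v : Fin n) : trackRow w v 0 = v.rev := by
  calc trackRow w v 0 = #{k | v < w k} := by simp [trackRow]
    _ = #(Ioi v) := card_equiv w (by simp)
    _ = v.rev := by rw [Fin.card_Ioi, Fin.val_rev]; omega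

theorem permTiling_corresponds (w : Equiv.Perm (Fin n)) : (permTiling w).Corresponds w := by
  intro j
  have htrack := reflTransGen_trackStep_trackRow w.injective (j := j) le_rfl
  rw [trackRow_perm_zero, trackRow_rev_self] at htrack
  refine ⟨_, codeTiling_trajectoryEndsAt _ (w j) htrack, ?_⟩
  simp only [DyckTiling.peakX, Fin.val_rev]
  omega

theorem inversionCode_eq_of_smallerBefore_eq {w w' : Equiv.Perm (Fin n)}
    (h : smallerBefore w = smallerBefore w') : inversionCode w = inversionCode w' := by
  funext b
  rcases lt_or_ge b n with hb | hb
  · obtain ⟨m, rfl⟩ := exists_val_rev_eq hb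
    have hsum := greaterBefore_add_smallerBefore w.injective m
    have hsum' := greaterBefore_add_smallerBefore w'.injective m
    rw [inversionCode_rev, inversionCode_rev]
    rw [h] at hsum
    omega
  · rw [inversionCode, inversionCode, dif_neg hb.not_gt, dif_neg hb.not_gt]

-- The trajectories of the tiling recover the permutation from its code.
theorem smallerBefore_injective :
    Function.Injective fun w : Equiv.Perm (Fin n) => smallerBefore w := by
  intro v w h
  have htiling : permTiling v = permTiling w := by
    simp only [permTiling, inversionCode_eq_of_smallerBefore_eq h]
  exact (permTiling_corresponds v).unique (htiling ▸ permTiling_corresponds w)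

/-- The sequences `e` of length `n` with `e i ≤ i` for each `i`. -/
def subexcedants (n : ℕ) : Finset (Fin n → ℕ) := Fintype.piFinset fun i => range (i + 1)

theorem mem_subexcedants {e : Fin n → ℕ} : e ∈ subexcedants n ↔ ∀ i, e i ≤ i := by
  simp [subexcedants]

theorem card_subexcedants (n : ℕ) : #(subexcedants n) = n.factorial := by
  rw [subexcedants, Fintype.card_piFinset]
  simp only [card_range]
  rw [Fin.prod_univ_eq_prod_range (· + 1), prod_range_add_one_eq_factorial]

theorem image_smallerBefore :
    univ.image (fun w : Equiv.Perm (Fin n) => smallerBefore w) = subexcedants n := by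
  refine eq_of_subset_of_card_le (image_subset_iff.2 fun w _ => mem_subexcedants.2 fun i => ?_) ?_
  · simpa using smallerBefore_le w i
  · rw [card_subexcedants, card_image_of_injective _ smallerBefore_injective, card_univ,
      Fintype.card_perm, Fintype.card_fin]

theorem exists_inversionCode_eq {c : ℕ → ℕ} (hc : IsCode n c) :
    ∃ w : Equiv.Perm (Fin n), inversionCode w = c := by
  have hle (i : Fin n) : c i.rev ≤ i := by
    by_contra! hlt
    have := hc _ _ hlt
    rw [Fin.val_rev] at this
    omega
  have hmem : (fun i : Fin n => i - c i.rev) ∈ subexcedants n :=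
    mem_subexcedants.2 fun i => Nat.sub_le _ _
  rw [← image_smallerBefore] at hmem
  obtain ⟨w, -, hw⟩ := mem_image.1 hmem
  refine ⟨w, funext fun b => ?_⟩
  rcases lt_or_ge b n with hb | hb
  · obtain ⟨i, rfl⟩ := exists_val_rev_eq hb
    have hsmaller : smallerBefore w i = i - c i.rev := congrFun hw i
    have hsum := greaterBefore_add_smallerBefore w.injective i
    rw [Fin.card_Iio] at hsum
    have := hle i
    rw [inversionCode_rev]
    omega
  · have : ¬0 < c b := fun h => by have := hc b 0 h; omega
    rw [inversionCode, dif_neg hb.not_gt]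
    omega

theorem corresponds_iff {w : Equiv.Perm (Fin n)} {T : DyckTiling n} :
    T.Corresponds w ↔ T = permTiling w := by
  refine ⟨fun h => ?_, fun h => h ▸ permTiling_corresponds w⟩
  obtain ⟨w', hw'⟩ := exists_inversionCode_eq T.isCode_code
  have hT : T = permTiling w' := by
    refine T.eq_codeTiling.trans ?_
    simp only [permTiling, hw']
  rw [h.unique (hT ▸ permTiling_corresponds w' : T.Corresponds w'), hT]

theorem weight_permTiling (w : Equiv.Perm (Fin n)) :
    (permTiling w).weight = ∑ i, greaterBefore w i := by
  rw [permTiling, weight_codeTiling, ← Fin.sum_univ_eq_sum_range (inversionCode w),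
    ← Equiv.sum_comp Fin.revPerm]
  simp only [Fin.revPerm_apply, inversionCode_rev]

theorem weight_permTiling_add_sum_smallerBefore (w : Equiv.Perm (Fin n)) :
    (permTiling w).weight + ∑ i, smallerBefore w i = n.choose 2 := by
  rw [weight_permTiling, ← sum_add_distrib]
  simp only [greaterBefore_add_smallerBefore w.injective, Fin.card_Iio]
  rw [Fin.sum_univ_eq_sum_range (fun i => i), sum_range_id, Nat.choose_two_right]

theorem mem_perms231Avoiding_iff {w : Equiv.Perm (Fin n)} :
    w ∈ perms231Avoiding n ↔ Monotone (smallerBefore w) := by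
  rw [perms231Avoiding, mem_filter, and_iff_right (mem_univ w),
    monotone_smallerBefore_iff w.injective]

end PermTiling

/-! ### `q`-Catalan numbers -/

section QCatalan

open Classical in
/-- The weakly increasing sequences `e` of length `m` with `e i ≤ i` and `e i ≤ x` for each `i`. -/
noncomputable def ballotSeqs (m x : ℕ) : Finset (Fin m → ℕ) :=
  {e ∈ subexcedants m | Monotone e ∧ ∀ i, e i ≤ x}

/-- The generating function of `ballotSeqs m x` by the sum of the terms. -/
noncomputable def ballotSum (m x : ℕ) : ℤ[X] := ∑ e ∈ ballotSeqs m x, Polynomial.X ^ ∑ i, e i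

theorem mem_ballotSeqs {m x : ℕ} {e : Fin m → ℕ} :
    e ∈ ballotSeqs m x ↔ (∀ i, e i ≤ i) ∧ Monotone e ∧ ∀ i, e i ≤ x := by
  rw [ballotSeqs, mem_filter, mem_subexcedants]

theorem ballotSeqs_self (n : ℕ) [DecidablePred (Monotone : (Fin n → ℕ) → Prop)] :
    ballotSeqs n n = {e ∈ subexcedants n | Monotone e} := by
  ext e
  rw [mem_ballotSeqs, mem_filter, mem_subexcedants]
  exact and_congr_right fun he => and_iff_left fun i => (he i).trans i.isLt.le

theorem mem_ballotSeqs_succ {m x : ℕ} {e : Fin (m + 1) → ℕ} :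
    e ∈ ballotSeqs (m + 1) x ↔
      (e (Fin.last m) ≤ x ∧ e (Fin.last m) ≤ m) ∧ Fin.init e ∈ ballotSeqs m (e (Fin.last m)) := by
  simp only [mem_ballotSeqs, Fin.forall_fin_succ', Fin.init, Fin.val_castSucc, Fin.val_last]
  constructor
  · rintro ⟨⟨hle, hlast⟩, hmono, -, hx⟩
    exact ⟨⟨hx, hlast⟩, hle, hmono.comp Fin.strictMono_castSucc.monotone,
      fun i => hmono (Fin.le_last _)⟩
  · rintro ⟨⟨hx, hlast⟩, hle, hmono, hinit⟩
    refine ⟨⟨hle, hlast⟩, fun i j hij => ?_, fun i => (hinit i).trans hx, hx⟩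
    cases j using Fin.lastCases with
    | last => cases i using Fin.lastCases with
      | last => exact le_rfl
      | cast i => exact hinit i
    | cast j => cases i using Fin.lastCases with
      | last => exact absurd hij (Fin.castSucc_lt_last j).not_ge
      | cast i => exact hmono hij

theorem ballotSum_zero (x : ℕ) : ballotSum 0 x = 1 := by
  have hseqs : ballotSeqs 0 x = univ :=
    eq_univ_iff_forall.2 fun e => mem_ballotSeqs.2 ⟨finZeroElim, finZeroElim, finZeroElim⟩
  simp [ballotSum, hseqs]

theorem ballotSum_succ (m x : ℕ) : ballotSum (m + 1) x =
    ∑ a ∈ range (x + 1) with a ≤ m, Polynomial.X ^ a * ballotSum m a := by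
  simp only [ballotSum, mul_sum, ← pow_add]
  rw [sum_sigma']
  symm
  refine sum_bij' (fun p _ => (Fin.snoc p.2 p.1 : Fin (m + 1) → ℕ))
    (fun e _ => ⟨e (Fin.last m), Fin.init e⟩) ?_ ?_ ?_ ?_ ?_
  · simp +contextual [mem_ballotSeqs_succ]
  · simp +contextual [mem_ballotSeqs_succ]
  · simp
  · simp
  · simp [Fin.sum_univ_castSucc, add_comm]

theorem coeff_succ_qPochhammer_zero (j : ℕ) : PowerSeries.coeff (j + 1) (qPochhammer 0) = 0 := by
  simp [qPochhammer, PowerSeries.coeff_one]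

theorem coeff_succ_qPochhammer_succ (k j : ℕ) :
    PowerSeries.coeff (j + 1) (qPochhammer (k + 1)) =
      PowerSeries.coeff (j + 1) (qPochhammer k)
        - Polynomial.X ^ k * PowerSeries.coeff j (qPochhammer k) := by
  rw [qPochhammer, prod_range_succ, ← qPochhammer, mul_sub, mul_one, map_sub, ← mul_assoc,
    PowerSeries.coeff_succ_mul_X, mul_comm, PowerSeries.coeff_C_mul]

theorem sum_range_mul_coeff_qPochhammer (f : ℕ → ℤ[X]) (k j : ℕ) :
    (∑ a ∈ range k, f a) * PowerSeries.coeff (j + 1) (qPochhammer k) =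
      ∑ a ∈ range k, f a * PowerSeries.coeff (j + 1) (qPochhammer a)
        - ∑ b ∈ range k, Polynomial.X ^ b * (∑ a ∈ range (b + 1), f a)
          * PowerSeries.coeff j (qPochhammer b) := by
  induction k with
  | zero => simp
  | succ k ih =>
    rw [coeff_succ_qPochhammer_succ, mul_sub, sum_range_succ f, add_mul, ih]
    simp only [sum_range_succ]
    ring

theorem ballotSum_succ_mul_coeff_qPochhammer (k j : ℕ) :
    ballotSum (k + 1) (k + 1) * PowerSeries.coeff (j + 1) (qPochhammer (k + 2)) =
      ∑ a ∈ range (k + 1),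
          Polynomial.X ^ a * ballotSum k a * PowerSeries.coeff (j + 1) (qPochhammer a)
        - ∑ b ∈ range (k + 2),
          Polynomial.X ^ b * ballotSum (k + 1) b * PowerSeries.coeff j (qPochhammer b) := by
  have hparts := sum_range_mul_coeff_qPochhammer
    (fun a => if a ≤ k then Polynomial.X ^ a * ballotSum k a else 0) (k + 2) j
  simp only [← sum_filter, ← ballotSum_succ, ite_mul, zero_mul] at hparts
  rw [hparts]
  congr 2
  ext a
  simp only [mem_filter, mem_range]
  omega

theorem sum_ballotSum_mul_coeff_qPochhammer {k m : ℕ} (hk : k ≤ m) :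
    ∑ i ∈ range (k + 1), ballotSum i i * PowerSeries.coeff (m + 1 - i) (qPochhammer (i + 1)) =
      -∑ b ∈ range (k + 1),
        Polynomial.X ^ b * ballotSum k b * PowerSeries.coeff (m - k) (qPochhammer b) := by
  induction k with
  | zero => simp [ballotSum_zero, coeff_succ_qPochhammer_succ, coeff_succ_qPochhammer_zero]
  | succ k ih =>
    obtain ⟨j, rfl⟩ := Nat.exists_eq_add_of_le hk
    have hsub : k + 1 + j + 1 - (k + 1) = j + 1 := by omega
    have hsub' : k + 1 + j - k = j + 1 := by omega
    rw [sum_range_succ, ih (by omega), hsub, hsub', Nat.add_sub_cancel_left,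
      ballotSum_succ_mul_coeff_qPochhammer]
    ring

theorem isQCatalanSeq_ballotSum : IsQCatalanSeq fun m => ballotSum m m := by
  rw [isQCatalanSeq_iff]
  rintro (- | m)
  · simp [ballotSum_zero]
  have hfilter : {a ∈ range (m + 1 + 1) | a ≤ m} = range (m + 1) := by
    ext a
    simp only [mem_filter, mem_range]
    omega
  have hsum := sum_ballotSum_mul_coeff_qPochhammer (le_refl m)
  simp only [Nat.sub_self, qPochhammer_coeff_zero, mul_one] at hsum
  rw [Fin.sum_univ_eq_sum_range fun k =>
      ballotSum k k * PowerSeries.coeff (m + 1 - k) (qPochhammer (k + 1)), hsum, ballotSum_succ,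
    hfilter, if_neg m.succ_ne_zero, zero_sub, neg_neg]

theorem qCatalan_eq_ballotSum (m : ℕ) : qCatalan m = ballotSum m m :=
  congrFun isQCatalanSeq_ballotSum.eq_qCatalan.symm m

theorem image_perms231Avoiding (n : ℕ) :
    (perms231Avoiding n).image (fun w : Equiv.Perm (Fin n) => smallerBefore w) =
      ballotSeqs n n := by
  classical
  rw [ballotSeqs_self, ← image_smallerBefore, filter_image]
  congr 1
  ext w
  rw [mem_perms231Avoiding_iff, mem_filter, and_iff_right (mem_univ w)]

theorem sum_perms231Avoiding (n : ℕ) :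
    ∑ w ∈ perms231Avoiding n, (LaurentPolynomial.T ((permTiling w).weight : ℤ) : ℤ[T;T⁻¹]) =
      LaurentPolynomial.T ((n.choose 2 : ℕ) : ℤ) *
        LaurentPolynomial.invert (Polynomial.toLaurent (qCatalan n)) := by
  rw [qCatalan_eq_ballotSum, ballotSum, ← image_perms231Avoiding,
    sum_image smallerBefore_injective.injOn, map_sum, map_sum, mul_sum]
  refine sum_congr rfl fun w _ => ?_
  rw [Polynomial.toLaurent_X_pow, LaurentPolynomial.invert_T, ← LaurentPolynomial.T_add,
    ← weight_permTiling_add_sum_smallerBefore w]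
  congr 1
  push_cast
  ring

end QCatalan

end

theorem mainTheorem10 (n : ℕ) :
    ∃ D : Equiv.Perm (Fin n) → DyckTiling n,
      (∀ (w : Equiv.Perm (Fin n)) (T : DyckTiling n), T.Corresponds w ↔ T = D w) ∧
      ∑ w ∈ perms231Avoiding n, (LaurentPolynomial.T ((D w).weight : ℤ) : ℤ[T;T⁻¹]) =
        LaurentPolynomial.T ((n.choose 2 : ℕ) : ℤ) *
          LaurentPolynomial.invert (Polynomial.toLaurent (qCatalan n)) :=
  ⟨permTiling, fun _ _ => corresponds_iff, sum_perms231Avoiding n⟩
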